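/- Let $p$ be a prime number and let $A$ be a discrete valuation ring (not necessarily complete) with maximal ideal $\mathfrak p_A$, whose residue field has characteristic $p$. All rings are commutative with $1$. An $\mathbb F_p$-algebra $R$ is called perfect if the endomorphism $x\mapsto x^p$ of $R$ is bijective. Let $\mathrm{CRP}_A$ be the full subcategory of the category of $A$-algebras consisting of those $B$ that are flat over $A$, complete and separated with respect to the ideal $\mathfrak p_A B$, and such that $\overline{B}:=B/\mathfrak p_A B$ is perfect. For an $\mathbb F_p$-algebra $S$, let $\mathrm{PerfAlg}_S$ be the full subcategory of the category of $S$-algebras consisting of the perfect ones. Then $\mathrm{CRP}_A$ has an initial object $A^{\mathrm u}$, and the functor \[ \mathrm{CRP}_A\to \mathrm{PerfAlg}_{\overline{A^{\mathrm u}}},\qquad B\mapsto \overline{B}, \] where $\overline{B}$ is an $\overline{A^{\mathrm u}}$-algebra via the reduction of the unique morphism $A^{\mathrm u}\to B$, is an equivalence of categories. -/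

import Mathlib

open CategoryTheory

universe u

namespace ResidualPerfection

/-- `R` is a perfect `𝔽_p`-algebra: `p = 0` in `R`, and the Frobenius endomorphism `x ↦ x ^ p`
is bijective. (The zero ring is one.) -/
structure IsPerfectAlg (p : ℕ) (R : Type u) [CommRing R] : Prop where
  cast_eq_zero : (p : R) = 0
  bijective_frobenius : Function.Bijective (fun x : R => x ^ p)

/-- The category of perfect `S`-algebras, a full subcategory of the category of `S`-algebras. -/
abbrev PerfAlg (p : ℕ) (S : Type u) [CommRing S] : Type (u + 1) :=
  ObjectProperty.FullSubcategory (C := CommAlgCat.{u} S) fun R => IsPerfectAlg p R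

section

variable (A : Type u) [CommRing A] [IsLocalRing A]

/-- The ideal `𝔭_A B` of `B` generated by the maximal ideal of `A`. -/
def extIdeal (B : Type u) [CommRing B] [Algebra A B] : Ideal B :=
  (IsLocalRing.maximalIdeal A).map (algebraMap A B)

/-- The reduction `B / 𝔭_A B`. -/
abbrev Reduction (B : Type u) [CommRing B] [Algebra A B] : Type u :=
  B ⧸ extIdeal A B

variable {A}

theorem extIdeal_le_comap {B C : Type u} [CommRing B] [Algebra A B] [CommRing C] [Algebra A C]
    (f : B →ₐ[A] C) : extIdeal A B ≤ (extIdeal A C).comap (f : B →+* C) := by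
  rw [← Ideal.map_le_iff_le_comap, extIdeal, extIdeal, Ideal.map_map, AlgHom.comp_algebraMap]

/-- The map `B / 𝔭_A B → C / 𝔭_A C` induced by a map of `A`-algebras `B → C`. -/
def reductionMap {B C : Type u} [CommRing B] [Algebra A B] [CommRing C] [Algebra A C]
    (f : B →ₐ[A] C) : Reduction A B →+* Reduction A C :=
  Ideal.quotientMap (extIdeal A C) (f : B →+* C) (extIdeal_le_comap f)

theorem reductionMap_id (B : Type u) [CommRing B] [Algebra A B] :
    reductionMap (AlgHom.id A B) = RingHom.id (Reduction A B) :=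
  Ideal.Quotient.ringHom_ext (RingHom.ext fun _ => rfl)

theorem reductionMap_comp {B C D : Type u} [CommRing B] [Algebra A B] [CommRing C] [Algebra A C]
    [CommRing D] [Algebra A D] (g : C →ₐ[A] D) (f : B →ₐ[A] C) :
    reductionMap (g.comp f) = (reductionMap g).comp (reductionMap f) :=
  Ideal.Quotient.ringHom_ext (RingHom.ext fun _ => rfl)

variable (A)

/-- `B` is a complete residual perfection of `A`: it is flat over `A`, complete (and separated)
for the `𝔭_A B`-adic topology, and `B / 𝔭_A B` is perfect. -/
structure IsCompleteResidualPerfection (p : ℕ) (B : Type u) [CommRing B] [Algebra A B] :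
    Prop where
  flat : Module.Flat A B
  complete : IsAdicComplete (extIdeal A B) B
  perfect : IsPerfectAlg p (Reduction A B)

/-- The category of complete residual perfections of `A`, a full subcategory of the category
of `A`-algebras. -/
abbrev CRP (p : ℕ) : Type (u + 1) :=
  ObjectProperty.FullSubcategory (C := CommAlgCat.{u} A)
    fun B => IsCompleteResidualPerfection A p B

variable {A} {p : ℕ}

/-- The reduction `B / 𝔭_A B` as a perfect algebra over the reduction of an initial object `U`;
the algebra structure is the reduction of the unique morphism `U ⟶ B`. -/
def reductionObj (U : CRP A p) (hU : Limits.IsInitial U) (B : CRP A p) :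
    PerfAlg p (Reduction A U.obj) where
  obj := @CommAlgCat.of (Reduction A U.obj) _ (Reduction A B.obj) _
    (reductionMap (hU.to B).hom.hom).toAlgebra
  property := B.property.perfect

/-- The functor `B ↦ B / 𝔭_A B` from complete residual perfections of `A` to perfect algebras
over the reduction of an initial object `U`. -/
def reductionFunctor (U : CRP A p) (hU : Limits.IsInitial U) :
    CRP A p ⥤ PerfAlg p (Reduction A U.obj) where
  obj B := reductionObj U hU B
  map {B C} f :=
    letI := (reductionMap (hU.to B).hom.hom).toAlgebra
    letI := (reductionMap (hU.to C).hom.hom).toAlgebra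
    ObjectProperty.homMk (CommAlgCat.ofHom
      { toRingHom := reductionMap f.hom.hom
        commutes' := fun r => by
          have h : (hU.to C).hom.hom = f.hom.hom.comp (hU.to B).hom.hom := by
            rw [← hU.to_comp f]; rfl
          change reductionMap f.hom.hom (reductionMap (hU.to B).hom.hom r) =
            reductionMap (hU.to C).hom.hom r
          rw [h, reductionMap_comp]; rfl })
  map_id B := by
    apply ObjectProperty.hom_ext
    apply CommAlgCat.hom_ext
    apply AlgHom.ext
    intro x
    exact RingHom.congr_fun (reductionMap_id (A := A) B.obj) x
  map_comp f g := by
    apply ObjectProperty.hom_ext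
    apply CommAlgCat.hom_ext
    apply AlgHom.ext
    intro x
    exact RingHom.congr_fun (reductionMap_comp g.hom.hom f.hom.hom) x

end

end ResidualPerfection

/-! Fix a uniformizer `ϖ`. An object of the category is then an `A`-algebra `B` in which the image
`t` of `ϖ` is a nonzerodivisor, with `B` complete for `t` and `R = B / t` perfect; this is
`IsPerfectLift`. Such a `B` receives a canonical map `theta` from `W(R)⟦X⟧` with `X ↦ t`, glued from
ghost components. It is surjective because every element is uniquely a Teichmüller series `∑ [c i] t
^ i` (`expansion_injective`, `expansion_surjective`). Since `t ∣ p`, its kernel contains some `ξ`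
with constant coefficient `p`.

Division by such a `ξ` controls everything. A map `g : R → S` of residue rings lifts to `B → D` once
the image of `ξ` dies in `D` (`exists_lift`), and a lift is unique because elements of `R` have all
`p`-power roots (`hom_ext`). Conversely `W(R)⟦X⟧ / ξ` is always a lift of `R`. Over an initial
object `U`, one `ξ` for `U` can be pushed forward to every perfect algebra over the reduction of
`U`: this gives fullness and essential surjectivity, and `hom_ext` gives faithfulness.

For the initial object, a homomorphism `A → B` is encoded by the Teichmüller coefficients of the
images of all `a : A`. Taking these as variables of a free perfect algebra `T`, being a homomorphism
becomes a system of equations in `T`; dividing by the radical ideal they generate gives the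
reduction of the initial object, and its lift is the object itself
(`exists_universal_isPerfectLift`). -/

namespace ResidualPerfection

/-! ### Principal adic completeness and congruences between `p`-power powers. -/

section Adic

variable {B : Type*} [CommRing B]

/-- Adic completeness for a principal ideal, in terms of divisibility. -/
theorem isAdicComplete_span_singleton {t : B} (hsep : ∀ x : B, (∀ n, t ^ n ∣ x) → x = 0)
    (hlim : ∀ f : ℕ → B, (∀ n, t ^ n ∣ f (n + 1) - f n) → ∃ L, ∀ n, t ^ n ∣ f n - L) :
    IsAdicComplete (Ideal.span {t}) B where
  haus' x hx := hsep x fun n => by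
    have := hx n
    rwa [SModEq.zero, smul_eq_mul, Ideal.mul_top, Ideal.span_singleton_pow,
      Ideal.mem_span_singleton] at this
  prec' f hf := by
    obtain ⟨L, hL⟩ := hlim f fun n => by
      have := (hf n.le_succ).symm
      rwa [SModEq.sub_mem, smul_eq_mul, Ideal.mul_top, Ideal.span_singleton_pow,
        Ideal.mem_span_singleton] at this
    refine ⟨L, fun n => ?_⟩
    rw [SModEq.sub_mem, smul_eq_mul, Ideal.mul_top, Ideal.span_singleton_pow,
      Ideal.mem_span_singleton]
    exact hL n

theorem eq_zero_of_forall_pow_dvd {t : B} (h : IsAdicComplete (Ideal.span {t}) B) {x : B}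
    (hx : ∀ n, t ^ n ∣ x) : x = 0 :=
  h.haus' x fun n => by
    rw [SModEq.zero, smul_eq_mul, Ideal.mul_top, Ideal.span_singleton_pow,
      Ideal.mem_span_singleton]
    exact hx n

theorem pow_dvd_sub_of_le {t : B} {f : ℕ → B} (hf : ∀ n, t ^ n ∣ f (n + 1) - f n) {m n : ℕ}
    (hmn : m ≤ n) : t ^ m ∣ f n - f m := by
  induction n, hmn using Nat.le_induction with
  | base => simp
  | succ n hmn ih =>
    have := dvd_add ((pow_dvd_pow t hmn).trans (hf n)) ih
    rwa [sub_add_sub_cancel] at this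

theorem exists_limit {t : B} (h : IsAdicComplete (Ideal.span {t}) B) (f : ℕ → B)
    (hf : ∀ n, t ^ n ∣ f (n + 1) - f n) : ∃ L, ∀ n, t ^ n ∣ f n - L := by
  obtain ⟨L, hL⟩ := h.prec' (f := f) fun {m n} hmn => by
    symm
    rw [SModEq.sub_mem, smul_eq_mul, Ideal.mul_top, Ideal.span_singleton_pow,
      Ideal.mem_span_singleton]
    exact pow_dvd_sub_of_le hf hmn
  refine ⟨L, fun n => ?_⟩
  have := hL n
  rwa [SModEq.sub_mem, smul_eq_mul, Ideal.mul_top, Ideal.span_singleton_pow,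
    Ideal.mem_span_singleton] at this

/-- In `x ^ p - y ^ p = (x - y) * ∑ x ^ i * y ^ (p - 1 - i)`, the sum is `p * y ^ (p - 1)` modulo
`t`, hence divisible by `t`. -/
theorem pow_succ_dvd_pow_sub_pow {p : ℕ} {t x y : B} (htp : t ∣ (p : B)) {k : ℕ}
    (h : t ^ (k + 1) ∣ x - y) : t ^ (k + 2) ∣ x ^ p - y ^ p := by
  have hxy : t ∣ x - y := (dvd_pow_self t k.succ_ne_zero).trans h
  rw [← (Commute.all x y).mul_geom_sum₂ p, pow_succ]
  refine mul_dvd_mul h ?_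
  rw [← Ideal.mem_span_singleton, ← Ideal.Quotient.eq_zero_iff_mem] at htp hxy ⊢
  rw [map_sub, sub_eq_zero] at hxy
  rw [map_natCast] at htp
  simp only [map_sum, map_mul, map_pow, hxy]
  rcases Nat.eq_zero_or_pos p with rfl | hp
  · simp
  · rw [Finset.sum_congr rfl (g := fun _ => (Ideal.Quotient.mk (Ideal.span {t}) y) ^ (p - 1))]
    · simp [htp]
    · intro i hi
      rw [← pow_add]
      congr 1
      have := Finset.mem_range.1 hi
      omega

theorem pow_succ_dvd_pow_pow_sub_pow_pow {p : ℕ} {t x y : B} (htp : t ∣ (p : B))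
    (h : t ∣ x - y) (n : ℕ) : t ^ (n + 1) ∣ x ^ p ^ n - y ^ p ^ n := by
  induction n with
  | zero => simpa using h
  | succ n ih =>
    rw [pow_succ p, pow_mul, pow_mul]
    exact pow_succ_dvd_pow_sub_pow htp ih

/-- Two ring homomorphisms agreeing modulo `t` agree as soon as they agree on generators of an
ideal modulo which every element has all `p`-power roots. -/
theorem ringHom_ext_of_dvd_sub {C : Type*} [CommRing C] {p : ℕ} {t : C} (htp : t ∣ (p : C))
    (hsep : ∀ x : C, (∀ n, t ^ n ∣ x) → x = 0) {f g : B →+* C} {s : Set B}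
    (hs : ∀ b ∈ s, f b = g b ∧ t ∣ f b)
    (hroot : ∀ b n, ∃ c, b - c ^ p ^ n ∈ Ideal.span s) (h : ∀ b, t ∣ f b - g b) : f = g := by
  have key : ∀ n b, t ^ n ∣ f b - g b := by
    intro n
    induction n with
    | zero => simp
    | succ n ih =>
      intro b
      -- Both parts of `b` gain precision: the `p ^ n`-th power by the congruence for powers, the
      -- part in the ideal because the generators map to multiples of `t`, which improves the
      -- inductive bound on their coefficients by one.
      obtain ⟨c, hc⟩ := hroot b n
      have h1 : t ^ (n + 1) ∣ f (c ^ p ^ n) - g (c ^ p ^ n) := by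
        rw [map_pow, map_pow]
        exact pow_succ_dvd_pow_pow_sub_pow_pow htp (h c) n
      have h2 : ∀ d ∈ Ideal.span s, t ^ (n + 1) ∣ f d - g d ∧ t ∣ g d := by
        intro d hd
        induction hd using Submodule.span_induction with
        | mem x hx => simpa [(hs x hx).1] using (hs x hx).2
        | zero => simp
        | add x y _ _ hx hy =>
          rw [map_add, map_add, add_sub_add_comm]
          exact ⟨dvd_add hx.1 hy.1, dvd_add hx.2 hy.2⟩
        | smul a x _ hx =>
          rw [smul_eq_mul, map_mul, map_mul]
          refine ⟨?_, hx.2.mul_left _⟩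
          have e : f a * f x - g a * g x = f a * (f x - g x) + (f a - g a) * g x := by ring
          rw [e]
          refine dvd_add (hx.1.mul_left _) ?_
          rw [pow_succ]
          exact mul_dvd_mul (ih a) hx.2
      have e : f b - g b = (f (b - c ^ p ^ n) - g (b - c ^ p ^ n)) +
          (f (c ^ p ^ n) - g (c ^ p ^ n)) := by
        rw [map_sub, map_sub]; ring
      rw [e]
      exact dvd_add (h2 _ hc).1 h1
  exact RingHom.ext fun b => sub_eq_zero.1 (hsep _ fun n => key n b)

end Adic

/-! ### Evaluation of power series in an adically complete ring. -/

section PowerSeriesEval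

open PowerSeries

variable {B : Type*} [CommRing B]

theorem eval₂_trunc_coe_eq {S : Type*} [CommRing S] {C : Type*} [CommRing C] (φ : S →+* C) {t : C}
    {n : ℕ} (ht : t ^ n = 0) (P : Polynomial S) :
    Polynomial.eval₂ φ t (trunc n (P : PowerSeries S)) = Polynomial.eval₂ φ t P := by
  have h : Polynomial.X ^ n ∣ P - trunc n (P : PowerSeries S) := by
    rw [Polynomial.X_pow_dvd_iff]
    intro d hd
    simp [coeff_trunc, hd]
  obtain ⟨Q, hQ⟩ := h
  rw [sub_eq_iff_eq_add.1 hQ]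
  simp [Polynomial.eval₂_add, Polynomial.eval₂_mul, ht]

/-- Evaluation of power series at a nilpotent element. -/
noncomputable def evalNilpotent {S : Type*} [CommRing S] {C : Type*} [CommRing C] (φ : S →+* C)
    {t : C} {n : ℕ} (ht : t ^ n = 0) : PowerSeries S →+* C where
  toFun f := Polynomial.eval₂ φ t (trunc n f)
  map_zero' := by simp
  map_one' := by
    have := eval₂_trunc_coe_eq φ ht (1 : Polynomial S)
    simpa using this
  map_add' f g := by simp [Polynomial.eval₂_add]
  map_mul' f g := by
    rw [← trunc_trunc_mul_trunc, ← Polynomial.coe_mul, eval₂_trunc_coe_eq φ ht,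
      Polynomial.eval₂_mul]

/-- Evaluation of power series at a topologically nilpotent element of a complete ring. -/
theorem exists_powerSeries_eval {S : Type*} [CommRing S] {t : B}
    (h : IsAdicComplete (Ideal.span {t}) B) (φ : S →+* B) :
    ∃ Φ : PowerSeries S →+* B, Φ X = t ∧ ∀ s, Φ (C s) = φ s := by
  have ht (n : ℕ) : (Ideal.Quotient.mk (Ideal.span {t} ^ n) t) ^ n = 0 := by
    rw [← map_pow, Ideal.Quotient.eq_zero_iff_mem]
    exact Ideal.pow_mem_pow (Ideal.mem_span_singleton_self t) n
  let f (n : ℕ) : PowerSeries S →+* B ⧸ Ideal.span {t} ^ n :=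
    evalNilpotent ((Ideal.Quotient.mk _).comp φ) (ht n)
  have hf {m n : ℕ} (hmn : m ≤ n) :
      (Ideal.Quotient.factorPow (Ideal.span {t}) hmn).comp (f n) = f m := by
    ext x
    change Ideal.Quotient.factorPow (Ideal.span {t}) hmn (Polynomial.eval₂ _ _ (trunc n x)) =
      Polynomial.eval₂ _ _ (trunc m x)
    rw [Polynomial.hom_eval₂, ← trunc_trunc_of_le x hmn, eval₂_trunc_coe_eq _ (ht m)]
    rfl
  have hfP (n : ℕ) (P : Polynomial S) : f n P = Ideal.Quotient.mk _ (Polynomial.eval₂ φ t P) := by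
    rw [Polynomial.hom_eval₂]
    exact eval₂_trunc_coe_eq _ (ht n) P
  have hP (P : Polynomial S) :
      IsAdicComplete.liftRingHom (Ideal.span {t}) f hf P = Polynomial.eval₂ φ t P := by
    rw [← sub_eq_zero]
    refine eq_zero_of_forall_pow_dvd h fun n => ?_
    rw [← Ideal.mem_span_singleton, ← Ideal.span_singleton_pow, ← Ideal.Quotient.eq_zero_iff_mem,
      map_sub, IsAdicComplete.mk_liftRingHom, hfP, sub_self]
  refine ⟨IsAdicComplete.liftRingHom (Ideal.span {t}) f hf, ?_, fun s => ?_⟩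
  · simpa using hP Polynomial.X
  · simpa using hP (Polynomial.C s)

end PowerSeriesEval

/-! ### Witt vectors of perfect rings and their maps to complete rings. -/

section Witt

variable {p : ℕ}

theorem IsPerfectAlg.exists_pow_eq {R : Type*} [CommRing R] (h : IsPerfectAlg p R) (n : ℕ)
    (x : R) : ∃ y, y ^ p ^ n = x := by
  induction n with
  | zero => exact ⟨x, by simp⟩
  | succ n ih =>
    obtain ⟨y, rfl⟩ := ih
    obtain ⟨z, rfl⟩ := h.bijective_frobenius.2 y
    exact ⟨z, by rw [pow_succ', pow_mul]⟩

theorem subsingleton_wittVector {R : Type*} [CommRing R] [Subsingleton R] :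
    Subsingleton (WittVector p R) :=
  ⟨fun _ _ => WittVector.ext fun _ => Subsingleton.elim _ _⟩

variable [Fact p.Prime]

theorem IsPerfectAlg.subsingleton_or_charP {R : Type*} [CommRing R] (h : IsPerfectAlg p R) :
    Subsingleton R ∨ (CharP R p ∧ PerfectRing R p) := by
  cases subsingleton_or_nontrivial R with
  | inl h => exact .inl h
  | inr hR =>
    refine .inr ⟨?_, ⟨h.bijective_frobenius⟩⟩
    exact (CharP.charP_iff_prime_eq_zero Fact.out).2 h.cast_eq_zero

theorem IsPerfectAlg.eq_zero_of_p_mul {R : Type*} [CommRing R] (h : IsPerfectAlg p R)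
    {x : WittVector p R} (hx : (p : WittVector p R) * x = 0) : x = 0 := by
  obtain h | ⟨_, _⟩ := h.subsingleton_or_charP
  · exact subsingleton_wittVector.elim _ _
  · exact WittVector.eq_zero_of_p_mul_eq_zero x (by rwa [mul_comm])

theorem IsPerfectAlg.p_dvd_iff {R : Type*} [CommRing R] (h : IsPerfectAlg p R)
    {x : WittVector p R} : (p : WittVector p R) ∣ x ↔ x.coeff 0 = 0 := by
  obtain h | ⟨_, _⟩ := h.subsingleton_or_charP
  · exact ⟨fun _ => Subsingleton.elim _ _,
      fun _ => subsingleton_wittVector.elim (p : WittVector p R) x ▸ dvd_rfl⟩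
  · rw [← Ideal.mem_span_singleton, WittVector.mem_span_p_iff_coeff_zero_eq_zero]

theorem wittVector_map_frobenius {R S : Type*} [CommRing R] [CommRing S] (f : R →+* S)
    (x : WittVector p R) :
    WittVector.map f (WittVector.frobenius x) = WittVector.frobenius (WittVector.map f x) := by
  ext n
  rw [WittVector.map_coeff, WittVector.coeff_frobenius, WittVector.coeff_frobenius]
  simp only [MvPolynomial.aeval_eq_eval₂Hom, MvPolynomial.map_eval₂Hom]
  congr 2
  exact RingHom.ext_int _ _

/-- The summand `p ^ i * x_i ^ (p ^ (n - i))` is divisible by `t` to the power `i + p ^ (n - i)`,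
which is at least `n + 1`. -/
theorem pow_succ_dvd_ghostComponent {B : Type*} [CommRing B] {t : B} (htp : t ∣ (p : B))
    {x : WittVector p B} (hx : ∀ i, t ∣ x.coeff i) (n : ℕ) :
    t ^ (n + 1) ∣ WittVector.ghostComponent n x := by
  rw [WittVector.ghostComponent_apply, wittPolynomial, map_sum]
  refine Finset.dvd_sum fun i hi => ?_
  rw [MvPolynomial.aeval_monomial, Finsupp.prod_single_index (by simp)]
  have hi' : n + 1 ≤ i + p ^ (n - i) := by
    have h1 := Finset.mem_range.1 hi
    have h2 := Nat.lt_pow_self (n := n - i) (Fact.out : p.Prime).one_lt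
    omega
  refine (pow_dvd_pow t hi').trans ?_
  rw [pow_add]
  refine mul_dvd_mul ?_ (pow_dvd_pow_of_dvd (hx i) _)
  simpa using pow_dvd_pow_of_dvd htp i

/-- The lift of the residue map of a complete ring with perfect residue ring `R` to the Witt
vectors of `R`. -/
theorem exists_wittVector_lift {B R : Type*} [CommRing B] [CommRing R] {t : B} {q : B →+* R}
    (hR : IsPerfectAlg p R) (hc : IsAdicComplete (Ideal.span {t}) B)
    (hq : Function.Surjective q) (hker : RingHom.ker q = Ideal.span {t}) :
    ∃ θ : WittVector p R →+* B, ∀ w, q (θ w) = w.coeff 0 := by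
  have htp : t ∣ (p : B) := by
    rw [← Ideal.mem_span_singleton, ← hker, RingHom.mem_ker, map_natCast, hR.cast_eq_zero]
  obtain hs | ⟨_, _⟩ := hR.subsingleton_or_charP
  -- The zero ring is perfect here but does not have characteristic `p`; in that case `B` is zero as
  -- well.
  · have h1 : t ∣ 1 := by
      rw [← Ideal.mem_span_singleton, ← hker, RingHom.mem_ker]
      exact Subsingleton.elim _ _
    have h0 : (1 : B) = 0 := eq_zero_of_forall_pow_dvd hc fun n => by
      simpa using pow_dvd_pow_of_dvd h1 n
    have : Subsingleton B := subsingleton_of_zero_eq_one h0.symm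
    exact ⟨⟨⟨⟨fun _ => 0, Subsingleton.elim _ _⟩, fun _ _ => Subsingleton.elim _ _⟩,
      Subsingleton.elim _ _, fun _ _ => Subsingleton.elim _ _⟩, fun _ => Subsingleton.elim _ _⟩
  let I : Ideal B := Ideal.span {t}
  have hsurj := WittVector.map_surjective (p := p) q hq
  -- Modulo `t ^ (n + 1)`, the `n`-th ghost component depends only on the coefficients modulo `t`,
  -- so it descends to `W(R)`.
  have hle (n : ℕ) : RingHom.ker (WittVector.map (p := p) q) ≤
      RingHom.ker ((Ideal.Quotient.mk (I ^ (n + 1))).comp (WittVector.ghostComponent n)) := by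
    intro x hx
    rw [RingHom.mem_ker, RingHom.comp_apply, Ideal.Quotient.eq_zero_iff_mem,
      Ideal.span_singleton_pow, Ideal.mem_span_singleton]
    refine pow_succ_dvd_ghostComponent htp (fun i => ?_) n
    rw [← Ideal.mem_span_singleton, ← hker, RingHom.mem_ker, ← WittVector.map_coeff,
      RingHom.mem_ker.1 hx, WittVector.zero_coeff]
  let gh (n : ℕ) : WittVector p R →+* B ⧸ I ^ (n + 1) :=
    RingHom.liftOfSurjective (WittVector.map q) hsurj ⟨_, hle n⟩
  have hgh (n : ℕ) (x : WittVector p B) : gh n (WittVector.map q x) =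
      Ideal.Quotient.mk _ (WittVector.ghostComponent n x) :=
    RingHom.liftOfSurjective_comp_apply ..
  let F : WittVector p R →+* WittVector p R := (WittVector.frobeniusEquiv p R).symm
  have hF (x : WittVector p R) : WittVector.frobenius (F x) = x :=
    (WittVector.frobeniusEquiv p R).apply_symm_apply x
  -- Frobenius shifts ghost components by one; the twist by its inverse iterates makes the levels
  -- compatible.
  let f (n : ℕ) : WittVector p R →+* B ⧸ I ^ (n + 1) := (gh n).comp (F ^ n)
  have hf (n : ℕ) : (Ideal.Quotient.factorPow I n.succ.le_succ).comp (f (n + 1)) = f n := by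
    ext y
    obtain ⟨x, hx⟩ := hsurj ((F ^ (n + 1)) y)
    have hx' : (F ^ n) y = WittVector.map q (WittVector.frobenius x) := by
      rw [wittVector_map_frobenius, hx, pow_succ', RingHom.mul_def, RingHom.comp_apply, hF]
    change Ideal.Quotient.factorPow I n.succ.le_succ (gh (n + 1) ((F ^ (n + 1)) y)) = gh n ((F ^ n) y)
    rw [hx', ← hx, hgh, hgh, WittVector.ghostComponent_frobenius]
    rfl
  have hmono : StrictMono fun n : ℕ => n + 1 := fun _ _ h => Nat.succ_lt_succ h
  refine ⟨IsAdicComplete.StrictMono.liftRingHom I hmono f (fun {m} => hf m), fun w => ?_⟩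
  have h0 := IsAdicComplete.StrictMono.mk_liftRingHom I hmono f (fun {m} => hf m) (n := 0) w
  obtain ⟨x, rfl⟩ := hsurj w
  rw [show f 0 (WittVector.map q x) = gh 0 (WittVector.map q x) from rfl, hgh,
    Ideal.Quotient.eq, zero_add, pow_one] at h0
  replace h0 := RingHom.mem_ker.1 (hker.ge h0)
  rw [map_sub, sub_eq_zero] at h0
  rw [h0, WittVector.map_coeff, WittVector.ghostComponent_apply, wittPolynomial_zero,
    MvPolynomial.aeval_X]

end Witt

open PowerSeries

/-! ### Power series over Witt vectors. -/

section WittSeries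

variable {p : ℕ} [Fact p.Prime] {R S : Type*} [CommRing R] [CommRing S]

/-- The functoriality of power series over Witt vectors. -/
noncomputable def wittSeriesMap (p : ℕ) [Fact p.Prime] {R S : Type*}
    [CommRing R] [CommRing S] (g : R →+* S) :
    PowerSeries (WittVector p R) →+* PowerSeries (WittVector p S) :=
  PowerSeries.map (WittVector.map g)

@[simp]
theorem wittSeriesMap_X (g : R →+* S) :
    wittSeriesMap p g X = X := by
  simp [wittSeriesMap]

@[simp]
theorem constantCoeff_wittSeriesMap (g : R →+* S)
    (w : PowerSeries (WittVector p R)) :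
    constantCoeff (wittSeriesMap p g w) = WittVector.map g (constantCoeff w) := by
  rw [wittSeriesMap, ← coeff_zero_eq_constantCoeff_apply, coeff_map,
    coeff_zero_eq_constantCoeff_apply]

theorem wittSeriesMap_comp {T : Type*} [CommRing T] (g : S →+* T)
    (f : R →+* S) (w : PowerSeries (WittVector p R)) :
    wittSeriesMap p (g.comp f) w = wittSeriesMap p g (wittSeriesMap p f w) := by
  ext n
  simp [wittSeriesMap]

/-- The power series whose coefficients are the Teichmüller lifts of a sequence. -/
noncomputable def teichSeries (p : ℕ) [Fact p.Prime] {R : Type*}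
    [CommRing R] (c : ℕ → R) : PowerSeries (WittVector p R) :=
  PowerSeries.mk fun i => WittVector.teichmuller p (c i)

theorem wittSeriesMap_teichSeries (g : R →+* S) (c : ℕ → R) :
    wittSeriesMap p g (teichSeries p c) = teichSeries p fun i => g (c i) := by
  ext n
  simp [wittSeriesMap, teichSeries]

theorem teichSeries_eq (c : ℕ → R) :
    teichSeries p c = C (WittVector.teichmuller p (c 0)) +
      X * teichSeries p fun i => c (i + 1) := by
  ext n : 1
  cases n with
  | zero => simp [teichSeries]
  | succ n => simp [teichSeries, coeff_succ_X_mul]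

end WittSeries

/-! ### Lifts of perfect algebras, Teichmüller expansions and lifting of maps. -/

variable {p : ℕ} {B R : Type*} [CommRing B] [CommRing R]

/-- `B` is a lift of the perfect `𝔽_p`-algebra `R` along the nonzerodivisor `t`: it is `t`-adically
complete, and `q` identifies `B / t` with `R`. -/
structure IsPerfectLift (p : ℕ) (t : B) (q : B →+* R) : Prop where
  regular : ∀ x, t * x = 0 → x = 0
  complete : IsAdicComplete (Ideal.span {t}) B
  surjective : Function.Surjective q
  ker_eq : RingHom.ker q = Ideal.span {t}
  perfect : IsPerfectAlg p R

namespace IsPerfectLift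

variable {t : B} {q : B →+* R} {D S : Type*} [CommRing D] [CommRing S] {t' : D} {q' : D →+* S}

theorem map_eq_zero_iff (h : IsPerfectLift p t q) {x : B} : q x = 0 ↔ t ∣ x := by
  rw [← RingHom.mem_ker, h.ker_eq, Ideal.mem_span_singleton]

theorem map_eq_iff (h : IsPerfectLift p t q) {x y : B} : q x = q y ↔ t ∣ x - y := by
  rw [← h.map_eq_zero_iff, map_sub, sub_eq_zero]

theorem map_t (h : IsPerfectLift p t q) : q t = 0 := h.map_eq_zero_iff.2 dvd_rfl

theorem dvd_p (h : IsPerfectLift p t q) : t ∣ (p : B) := by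
  rw [← h.map_eq_zero_iff, map_natCast, h.perfect.cast_eq_zero]

theorem cancel (h : IsPerfectLift p t q) {x y : B} (hxy : t * x = t * y) : x = y :=
  sub_eq_zero.1 (h.regular _ (by rw [mul_sub, hxy, sub_self]))

theorem eq_zero (h : IsPerfectLift p t q) {x : B} (hx : ∀ n, t ^ n ∣ x) : x = 0 :=
  eq_zero_of_forall_pow_dvd h.complete hx

/-- Homomorphisms of lifts are determined by their reductions. -/
theorem hom_ext (hB : IsPerfectLift p t q) (hD : IsPerfectLift p t' q') {f g : B →+* D}
    (hf : f t = t') (hg : g t = t') (h : ∀ b, q' (f b) = q' (g b)) : f = g := by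
  refine ringHom_ext_of_dvd_sub (p := p) hD.dvd_p (fun x => hD.eq_zero) (s := {t}) ?_ ?_
    fun b => hD.map_eq_iff.1 (h b)
  · rintro _ rfl
    simp [hf, hg]
  · intro b n
    obtain ⟨y, hy⟩ := hB.perfect.exists_pow_eq n (q b)
    obtain ⟨c, rfl⟩ := hB.surjective y
    refine ⟨c, ?_⟩
    rw [Ideal.mem_span_singleton, ← hB.map_eq_iff, map_pow, hy]

theorem exists_reduction (hB : IsPerfectLift p t q) (hD : IsPerfectLift p t' q') {f : B →+* D}
    (hf : f t = t') : ∃ g : R →+* S, ∀ b, q' (f b) = g (q b) := by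
  have hker : RingHom.ker q ≤ RingHom.ker (q'.comp f) := fun x hx => by
    obtain ⟨y, rfl⟩ := hB.map_eq_zero_iff.1 (RingHom.mem_ker.1 hx)
    rw [RingHom.mem_ker, RingHom.comp_apply, map_mul, hf, map_mul, hD.map_t, zero_mul]
  exact ⟨RingHom.liftOfSurjective q hB.surjective ⟨_, hker⟩, fun b =>
    (RingHom.liftOfSurjective_comp_apply q hB.surjective ⟨_, hker⟩ b).symm⟩

variable [Fact p.Prime]

/-- Homomorphisms from power series over Witt vectors to a lift are determined by their
reductions. -/
theorem powerSeries_hom_ext {T : Type*} [CommRing T] (hT : IsPerfectAlg p T)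
    (hD : IsPerfectLift p t' q') {f g : PowerSeries (WittVector p T) →+* D}
    (hf : f X = t') (hg : g X = t') (h : ∀ b, q' (f b) = q' (g b)) : f = g := by
  -- Modulo `X` and `p` the source becomes the perfect ring `T`, and Teichmüller representatives
  -- supply the `p`-power roots.
  refine ringHom_ext_of_dvd_sub (p := p) hD.dvd_p (fun x => hD.eq_zero)
    (s := {X, (p : PowerSeries (WittVector p T))}) ?_ ?_ fun b => hD.map_eq_iff.1 (h b)
  · rintro _ (rfl | rfl)
    · simp [hf, hg]
    · simpa using hD.dvd_p
  · intro b n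
    obtain ⟨y, hy⟩ := hT.exists_pow_eq n ((constantCoeff b).coeff 0)
    have h1 : (p : WittVector p T) ∣ constantCoeff b - (WittVector.teichmuller p y) ^ p ^ n := by
      rw [hT.p_dvd_iff, ← map_pow, hy]
      have := map_sub (WittVector.constantCoeff (p := p)) (constantCoeff b)
        (WittVector.teichmuller p ((constantCoeff b).coeff 0))
      simpa [WittVector.constantCoeff_apply] using this
    obtain ⟨z, hz⟩ := h1
    have h2 : X ∣ b - C (constantCoeff b) := by
      rw [X_dvd_iff]; simp
    refine ⟨C (WittVector.teichmuller p y), ?_⟩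
    have e : b - C (WittVector.teichmuller p y) ^ p ^ n =
        (b - C (constantCoeff b)) + (p : PowerSeries (WittVector p T)) * C z := by
      have h3 : (p : PowerSeries (WittVector p T)) * C z =
          C (constantCoeff b) - C (WittVector.teichmuller p y) ^ p ^ n := by
        rw [← map_pow, ← map_sub, hz, map_mul, map_natCast]
      rw [h3]; ring
    rw [e]
    refine Ideal.add_mem _ ?_ (Ideal.mul_mem_right _ _ (Ideal.subset_span (by simp)))
    obtain ⟨w, hw⟩ := h2
    rw [hw]
    exact Ideal.mul_mem_right _ _ (Ideal.subset_span (by simp))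

theorem exists_theta (h : IsPerfectLift p t q) :
    ∃ Θ : PowerSeries (WittVector p R) →+* B, Θ X = t ∧
      ∀ w, q (Θ w) = (constantCoeff w).coeff 0 := by
  obtain ⟨θ, hθ⟩ := exists_wittVector_lift h.perfect h.complete h.surjective h.ker_eq
  obtain ⟨Θ, hX, hC⟩ := exists_powerSeries_eval h.complete θ
  refine ⟨Θ, hX, fun w => ?_⟩
  have h2 : X ∣ w - C (constantCoeff w) := by
    rw [X_dvd_iff]; simp
  obtain ⟨v, hv⟩ := h2
  rw [sub_eq_iff_eq_add.1 hv, map_add, map_add, map_mul, map_mul, hX, h.map_t, hC, hθ]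
  simp

/-- The canonical surjection onto a lift from power series over Witt vectors. -/
noncomputable def theta (h : IsPerfectLift p t q) : PowerSeries (WittVector p R) →+* B :=
  h.exists_theta.choose

@[simp]
theorem theta_X (h : IsPerfectLift p t q) : h.theta X = t := h.exists_theta.choose_spec.1

@[simp]
theorem map_theta (h : IsPerfectLift p t q) (w : PowerSeries (WittVector p R)) :
    q (h.theta w) = (constantCoeff w).coeff 0 := h.exists_theta.choose_spec.2 w

theorem theta_unique (h : IsPerfectLift p t q) {f : PowerSeries (WittVector p R) →+* B}
    (hX : f X = t) (hf : ∀ w, q (f w) = (constantCoeff w).coeff 0) : f = h.theta :=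
  powerSeries_hom_ext h.perfect h hX h.theta_X fun w => by rw [hf, h.map_theta]

theorem theta_naturality (hB : IsPerfectLift p t q) (hD : IsPerfectLift p t' q') {f : B →+* D}
    {g : R →+* S} (hf : f t = t') (hfg : ∀ b, q' (f b) = g (q b))
    (w : PowerSeries (WittVector p R)) :
    f (hB.theta w) = hD.theta (wittSeriesMap p g w) := by
  refine RingHom.congr_fun (f := f.comp hB.theta) (g := hD.theta.comp (wittSeriesMap p g))
    (powerSeries_hom_ext hB.perfect hD ?_ ?_ fun b => ?_) w
  · simp [hf]
  · simp
  · simp [hfg]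

/-- Evaluation of a Teichmüller expansion `∑ [c i] t ^ i` in a lift. -/
noncomputable def expansion (h : IsPerfectLift p t q) (c : ℕ → R) : B :=
  h.theta (teichSeries p c)

theorem map_expansion_zero (h : IsPerfectLift p t q) (c : ℕ → R) : q (h.expansion c) = c 0 := by
  simp [expansion, teichSeries]

theorem expansion_eq (h : IsPerfectLift p t q) (c : ℕ → R) :
    h.expansion c = h.theta (C (WittVector.teichmuller p (c 0))) +
      t * h.expansion fun i => c (i + 1) := by
  rw [expansion, teichSeries_eq, map_add, map_mul, theta_X, expansion]

theorem expansion_zero (h : IsPerfectLift p t q) : h.expansion (fun _ => 0) = 0 := by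
  have : teichSeries p (fun _ => (0 : R)) = 0 := by
    ext n : 1
    simp [teichSeries]
  rw [expansion, this, map_zero]

theorem expansion_naturality (hB : IsPerfectLift p t q) (hD : IsPerfectLift p t' q') {f : B →+* D}
    {g : R →+* S} (hf : f t = t') (hfg : ∀ b, q' (f b) = g (q b)) (c : ℕ → R) :
    f (hB.expansion c) = hD.expansion fun i => g (c i) := by
  rw [expansion, hB.theta_naturality hD hf hfg, wittSeriesMap_teichSeries, expansion]

theorem expansion_injective (h : IsPerfectLift p t q) : Function.Injective h.expansion := by
  intro c d hcd
  have key : ∀ n (c d : ℕ → R), h.expansion c = h.expansion d → c n = d n := by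
    intro n
    induction n with
    | zero =>
      intro c d hcd
      rw [← h.map_expansion_zero c, hcd, h.map_expansion_zero]
    | succ n ih =>
      intro c d hcd
      have h0 : c 0 = d 0 := by rw [← h.map_expansion_zero c, hcd, h.map_expansion_zero]
      rw [h.expansion_eq c, h.expansion_eq d, h0, add_right_inj] at hcd
      exact ih _ _ (h.cancel hcd)
  exact funext fun n => key n c d hcd

theorem expansion_surjective (h : IsPerfectLift p t q) : Function.Surjective h.expansion := by
  intro b
  have hstep (x : B) : ∃ y, x = h.theta (C (WittVector.teichmuller p (q x))) + t * y := by
    have : t ∣ x - h.theta (C (WittVector.teichmuller p (q x))) := by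
      rw [← h.map_eq_iff]; simp
    obtain ⟨y, hy⟩ := this
    exact ⟨y, by rw [← hy]; ring⟩
  choose s hs using hstep
  have key (n : ℕ) : ∀ x, t ^ n ∣ x - h.expansion fun i => q (s^[i] x) := by
    induction n with
    | zero => simp
    | succ n ih =>
      intro x
      have e : x - h.expansion (fun i => q (s^[i] x)) =
          t * (s x - h.expansion fun i => q (s^[i] (s x))) := by
        rw [h.expansion_eq]
        nth_rewrite 1 [hs x]
        simp only [Function.iterate_zero, id, Function.iterate_succ, Function.comp_apply]
        ring
      rw [e, pow_succ']
      exact mul_dvd_mul_left t (ih (s x))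
  exact ⟨fun i => q (s^[i] b), (sub_eq_zero.1 (h.eq_zero fun n => key n b)).symm⟩

theorem theta_surjective (h : IsPerfectLift p t q) : Function.Surjective h.theta := fun b =>
  let ⟨c, hc⟩ := h.expansion_surjective b
  ⟨teichSeries p c, hc⟩

/-- The kernel of `theta` contains an element congruent to `p` modulo `X`. -/
theorem exists_theta_eq_zero (h : IsPerfectLift p t q) :
    ∃ ξ : PowerSeries (WittVector p R), constantCoeff ξ = p ∧ h.theta ξ = 0 := by
  obtain ⟨c, hc⟩ := h.dvd_p
  obtain ⟨w, rfl⟩ := h.theta_surjective c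
  exact ⟨(p : PowerSeries (WittVector p R)) - X * w, by simp, by rw [map_sub, map_mul, map_natCast, theta_X, hc, sub_self]⟩

/-- A homomorphism of residue rings lifts as soon as it respects an element of the kernel
of `theta` congruent to `p`. -/
theorem exists_lift (hB : IsPerfectLift p t q) (hD : IsPerfectLift p t' q') (g : R →+* S)
    {ξ : PowerSeries (WittVector p R)} (hξ : constantCoeff ξ = p) (hBξ : hB.theta ξ = 0)
    (hDξ : hD.theta (wittSeriesMap p g ξ) = 0) :
    ∃ f : B →+* D, f t = t' ∧ ∀ b, q' (f b) = g (q b) := by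
  let G := hD.theta.comp (wittSeriesMap p g)
  have hG : ∀ n w, hB.theta w = 0 → t' ^ n ∣ G w := by
    intro n
    induction n with
    | zero => simp
    | succ n ih =>
      intro w hw
      -- Division by `ξ`: the constant coefficient is `p * v`, so `w = ξ * C v + X * w'`, and
      -- regularity of `t` puts `w'` back in the kernel.
      have h0 : (p : WittVector p R) ∣ constantCoeff w := by
        rw [hB.perfect.p_dvd_iff, ← hB.map_theta, hw, map_zero]
      obtain ⟨v, hv⟩ := h0
      have h1 : X ∣ w - ξ * C v := by
        rw [X_dvd_iff]; simp [hv, hξ]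
      obtain ⟨w', hw'⟩ := h1
      have h2 : hB.theta w' = 0 := by
        apply hB.regular
        have := congrArg hB.theta hw'
        rwa [map_sub, map_mul, hw, hBξ, zero_mul, sub_zero, map_mul, theta_X, eq_comm] at this
      have h3 : G w = t' * G w' := by
        rw [sub_eq_iff_eq_add.1 hw', map_add, map_mul, map_mul, show G ξ = 0 from hDξ, zero_mul,
          add_zero]
        congr 1
        simp [G]
      rw [h3, pow_succ']
      exact mul_dvd_mul_left _ (ih _ h2)
  have hker : RingHom.ker hB.theta ≤ RingHom.ker G := fun w hw => by
    rw [RingHom.mem_ker] at hw ⊢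
    exact hD.eq_zero fun n => hG n w hw
  have hf (w) : RingHom.liftOfSurjective hB.theta hB.theta_surjective ⟨G, hker⟩ (hB.theta w) =
      G w := RingHom.liftOfSurjective_comp_apply ..
  refine ⟨RingHom.liftOfSurjective hB.theta hB.theta_surjective ⟨G, hker⟩, ?_, fun b => ?_⟩
  · have := hf X
    rw [theta_X] at this
    rw [this]
    simp [G]
  · obtain ⟨w, rfl⟩ := hB.theta_surjective b
    rw [hf]
    simp [G]

end IsPerfectLift

/-! ### Construction of lifts as quotients of power series over Witt vectors. -/

section Construction

variable [Fact p.Prime]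

/-- The lift `W(R)⟦X⟧ / ξ` of a perfect `𝔽_p`-algebra `R`. -/
abbrev WittQuotient (ξ : PowerSeries (WittVector p R)) :=
  PowerSeries (WittVector p R) ⧸ Ideal.span {ξ}

/-- Modulo `X`, `ξ` is `p`, a nonzerodivisor on `W(R)`; one factor `X` is thus extracted from `y` at
a time. This gives regularity and separatedness of the quotient. -/
theorem X_pow_dvd_of_dvd_mul (hR : IsPerfectAlg p R) {ξ : PowerSeries (WittVector p R)}
    (hξ : constantCoeff ξ = p) {n : ℕ} :
    ∀ {y : PowerSeries (WittVector p R)}, X ^ n ∣ ξ * y → X ^ n ∣ y := by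
  induction n with
  | zero => simp
  | succ n ih =>
    intro y hy
    have h0 : X ∣ y := by
      rw [X_dvd_iff]
      have : X ∣ ξ * y := (dvd_pow_self X n.succ_ne_zero).trans hy
      rw [X_dvd_iff, map_mul, hξ] at this
      exact hR.eq_zero_of_p_mul this
    obtain ⟨z, rfl⟩ := h0
    rw [pow_succ'] at hy ⊢
    obtain ⟨v, hv⟩ := hy
    refine mul_dvd_mul_left X (ih ⟨v, X_mul_cancel ?_⟩)
    rw [← mul_assoc X (X ^ n), ← hv]; ring

/-- The residue map of `W(R)⟦X⟧ / ξ`. -/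
noncomputable def WittQuotient.residue (hR : IsPerfectAlg p R) {ξ : PowerSeries (WittVector p R)}
    (hξ : constantCoeff ξ = p) : WittQuotient ξ →+* R :=
  Ideal.Quotient.lift _ ((WittVector.constantCoeff (p := p)).comp constantCoeff) fun x hx => by
    obtain ⟨y, rfl⟩ := Ideal.mem_span_singleton.1 hx
    rw [RingHom.comp_apply, map_mul, map_mul, hξ, map_natCast, hR.cast_eq_zero, zero_mul]

theorem WittQuotient.residue_mk (hR : IsPerfectAlg p R) {ξ : PowerSeries (WittVector p R)}
    (hξ : constantCoeff ξ = p) (w : PowerSeries (WittVector p R)) :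
    WittQuotient.residue hR hξ (Ideal.Quotient.mk _ w) = (constantCoeff w).coeff 0 := rfl

theorem WittQuotient.isPerfectLift (hR : IsPerfectAlg p R) {ξ : PowerSeries (WittVector p R)}
    (hξ : constantCoeff ξ = p) :
    IsPerfectLift p (Ideal.Quotient.mk (Ideal.span {ξ}) X) (WittQuotient.residue hR hξ) where
  regular x hx := by
    obtain ⟨w, rfl⟩ := Ideal.Quotient.mk_surjective x
    rw [← map_mul, Ideal.Quotient.eq_zero_iff_mem, Ideal.mem_span_singleton] at hx
    obtain ⟨y, hy⟩ := hx
    have h1 : X ^ 1 ∣ y := X_pow_dvd_of_dvd_mul hR hξ (by rw [← hy, pow_one]; exact ⟨w, rfl⟩)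
    rw [pow_one] at h1
    obtain ⟨z, rfl⟩ := h1
    rw [Ideal.Quotient.eq_zero_iff_mem, Ideal.mem_span_singleton]
    exact ⟨z, X_mul_cancel (by rw [hy]; ring)⟩
  complete := by
    have hS : IsAdicComplete (Ideal.span {(X : PowerSeries (WittVector p R))})
        (PowerSeries (WittVector p R)) := inferInstance
    apply isAdicComplete_span_singleton
    · intro x hx
      obtain ⟨w, rfl⟩ := Ideal.Quotient.mk_surjective x
      have h1 (n : ℕ) : ∃ y, X ^ n ∣ w - ξ * y := by
        obtain ⟨v, hv⟩ := hx n
        obtain ⟨v, rfl⟩ := Ideal.Quotient.mk_surjective v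
        rw [← map_pow, ← map_mul, Ideal.Quotient.eq, Ideal.mem_span_singleton] at hv
        obtain ⟨y, hy⟩ := hv
        exact ⟨y, v, by rw [← hy]; ring⟩
      choose y hy using h1
      -- The approximate quotients of `w` by `ξ` form a Cauchy sequence, since `ξ` can be cancelled
      -- from divisibility by `X ^ n`; their limit is an exact quotient.
      obtain ⟨L, hL⟩ := exists_limit hS y fun n => by
        apply X_pow_dvd_of_dvd_mul hR hξ
        have := dvd_sub (hy n) ((pow_dvd_pow X n.le_succ).trans (hy (n + 1)))
        convert this using 1
        ring
      have : w - ξ * L = 0 := eq_zero_of_forall_pow_dvd hS fun n => by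
        have := dvd_add (hy n) ((hL n).mul_left ξ)
        convert this using 1
        ring
      rw [Ideal.Quotient.eq_zero_iff_mem, Ideal.mem_span_singleton]
      exact ⟨L, sub_eq_zero.1 this⟩
    · intro f hf
      choose v hv using hf
      choose w hw using fun n => Ideal.Quotient.mk_surjective (v n)
      obtain ⟨f0, hf0⟩ := Ideal.Quotient.mk_surjective (f 0)
      -- Lifting the increments instead of the terms keeps the lifted sequence Cauchy.
      let F (n : ℕ) : PowerSeries (WittVector p R) := f0 + ∑ i ∈ Finset.range n, X ^ i * w i
      have hF (n : ℕ) : Ideal.Quotient.mk (Ideal.span {ξ}) (F n) = f n := by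
        induction n with
        | zero => simp [F, hf0]
        | succ n ih =>
          have : F (n + 1) = F n + X ^ n * w n := by
            simp only [F, Finset.sum_range_succ, add_assoc]
          rw [this, map_add, ih, map_mul, map_pow, hw, ← hv]
          ring
      obtain ⟨L, hL⟩ := exists_limit hS F fun n => by
        simp only [F, Finset.sum_range_succ]
        exact ⟨w n, by ring⟩
      refine ⟨Ideal.Quotient.mk _ L, fun n => ?_⟩
      rw [← hF, ← map_sub, ← map_pow]
      exact map_dvd _ (hL n)
  surjective r := ⟨Ideal.Quotient.mk _ (C (WittVector.teichmuller p r)), by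
    rw [WittQuotient.residue_mk]; simp⟩
  ker_eq := by
    ext x
    obtain ⟨w, rfl⟩ := Ideal.Quotient.mk_surjective x
    rw [RingHom.mem_ker, Ideal.mem_span_singleton, WittQuotient.residue_mk, ← hR.p_dvd_iff]
    constructor
    · rintro ⟨v, hv⟩
      have h1 : X ∣ w - ξ * C v := by
        rw [X_dvd_iff]; simp [hv, hξ]
      have := map_dvd (Ideal.Quotient.mk (Ideal.span {ξ})) h1
      rwa [map_sub, map_mul, Ideal.Quotient.mk_singleton_self, zero_mul, sub_zero] at this
    · rintro ⟨v, hv⟩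
      obtain ⟨v, rfl⟩ := Ideal.Quotient.mk_surjective v
      rw [← map_mul, Ideal.Quotient.eq, Ideal.mem_span_singleton] at hv
      obtain ⟨y, hy⟩ := hv
      rw [sub_eq_iff_eq_add.1 hy]
      simp [hξ]
  perfect := hR

theorem WittQuotient.theta_eq (hR : IsPerfectAlg p R) {ξ : PowerSeries (WittVector p R)}
    (hξ : constantCoeff ξ = p) : (WittQuotient.isPerfectLift hR hξ).theta = Ideal.Quotient.mk _ :=
  ((WittQuotient.isPerfectLift hR hξ).theta_unique rfl fun w =>
    WittQuotient.residue_mk hR hξ w).symm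

theorem WittQuotient.theta_self (hR : IsPerfectAlg p R) {ξ : PowerSeries (WittVector p R)}
    (hξ : constantCoeff ξ = p) : (WittQuotient.isPerfectLift hR hξ).theta ξ = 0 := by
  rw [WittQuotient.theta_eq, Ideal.Quotient.mk_singleton_self]

end Construction

/-! ### Free perfect algebras and the universal lift under `A`. -/

section Universal

variable {p : ℕ} [Fact p.Prime]

/-- Surjectivity of Frobenius is inherited; radicality gives injectivity, as `a ^ p - b ^ p = (a -
b) ^ p`. -/
theorem isPerfectAlg_quotient {T : Type*} [CommRing T] (hT : IsPerfectAlg p T) {I : Ideal T}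
    (hI : I.IsRadical) : IsPerfectAlg p (T ⧸ I) where
  cast_eq_zero := by
    rw [← map_natCast (Ideal.Quotient.mk I), hT.cast_eq_zero, map_zero]
  bijective_frobenius := by
    constructor
    · intro x y hxy
      obtain ⟨a, rfl⟩ := Ideal.Quotient.mk_surjective x
      obtain ⟨b, rfl⟩ := Ideal.Quotient.mk_surjective y
      obtain hs | ⟨_, _⟩ := hT.subsingleton_or_charP
      · rw [Subsingleton.elim a b]
      · refine Ideal.Quotient.eq.2 (hI ⟨p, ?_⟩)
        have : (Ideal.Quotient.mk I) (a ^ p) = (Ideal.Quotient.mk I) (b ^ p) := by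
          simpa using hxy
        rw [sub_pow_char]
        exact Ideal.Quotient.eq.1 this
    · intro x
      obtain ⟨a, rfl⟩ := Ideal.Quotient.mk_surjective x
      obtain ⟨b, rfl⟩ := hT.bijective_frobenius.2 a
      exact ⟨Ideal.Quotient.mk I b, by simp⟩

theorem IsPerfectAlg.eq_zero_of_pow_eq_zero {R : Type*} [CommRing R] (hR : IsPerfectAlg p R)
    {x : R} {n : ℕ} (hx : x ^ n = 0) : x = 0 := by
  have key (m : ℕ) : x ^ p ^ m = 0 → x = 0 := by
    induction m with
    | zero => simp
    | succ m ih =>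
      intro h
      refine ih (hR.bijective_frobenius.1 ?_)
      simp only [← pow_mul, ← pow_succ, h, zero_pow (Fact.out : p.Prime).ne_zero]
  exact key n (pow_eq_zero_of_le (Nat.lt_pow_self (Fact.out : p.Prime).one_lt).le hx)

variable (p) in
/-- The free perfect `𝔽_p`-algebra on a type of variables. -/
abbrev FreePerfectAlg (σ : Type*) := PerfectClosure (MvPolynomial σ (ZMod p)) p

namespace FreePerfectAlg

theorem isPerfectAlg (σ : Type*) : IsPerfectAlg p (FreePerfectAlg p σ) :=
  ⟨CharP.cast_eq_zero _ p, PerfectRing.bijective_frobenius⟩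

variable (p) in
/-- The variables of the free perfect `𝔽_p`-algebra. -/
noncomputable def var {σ : Type*} (i : σ) : FreePerfectAlg p σ :=
  PerfectClosure.of _ p (MvPolynomial.X i)

theorem exists_hom {σ R : Type*} [CommRing R] (hR : IsPerfectAlg p R) (c : σ → R) :
    ∃ g : FreePerfectAlg p σ →+* R, ∀ i, g (var p i) = c i := by
  obtain hs | ⟨_, _⟩ := hR.subsingleton_or_charP
  · exact ⟨⟨⟨⟨fun _ => 0, Subsingleton.elim _ _⟩, fun _ _ => Subsingleton.elim _ _⟩,
      Subsingleton.elim _ _, fun _ _ => Subsingleton.elim _ _⟩, fun _ => Subsingleton.elim _ _⟩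
  · let g₀ : MvPolynomial σ (ZMod p) →+* R := MvPolynomial.eval₂Hom (ZMod.castHom dvd_rfl R) c
    refine ⟨PerfectClosure.lift _ p R g₀, fun i => ?_⟩
    have := RingHom.congr_fun ((PerfectClosure.lift _ p R).symm_apply_apply g₀)
      (MvPolynomial.X i)
    refine Eq.trans this ?_
    simp [g₀]

theorem hom_ext {σ R : Type*} [CommRing R] (hR : IsPerfectAlg p R)
    {f g : FreePerfectAlg p σ →+* R} (h : ∀ i, f (var p i) = g (var p i)) : f = g := by
  obtain hs | ⟨_, _⟩ := hR.subsingleton_or_charP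
  · exact RingHom.ext fun _ => Subsingleton.elim _ _
  · apply (PerfectClosure.lift _ p R).symm.injective
    change f.comp (PerfectClosure.of _ p) = g.comp (PerfectClosure.of _ p)
    refine MvPolynomial.ringHom_ext' (Subsingleton.elim _ _) h

end FreePerfectAlg

namespace IsPerfectLift

variable {B R D S : Type*} [CommRing B] [CommRing R] {t : B} {q : B →+* R} [CommRing D]
  [CommRing S] {t' : D} {q' : D →+* S}

/-- The coefficients of the Teichmüller expansion of an element of a lift. -/
noncomputable def coeffs (h : IsPerfectLift p t q) : B → ℕ → R :=
  Function.surjInv h.expansion_surjective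

theorem expansion_coeffs (h : IsPerfectLift p t q) (b : B) : h.expansion (h.coeffs b) = b :=
  Function.surjInv_eq h.expansion_surjective b

theorem coeffs_zero (h : IsPerfectLift p t q) (b : B) : h.coeffs b 0 = q b := by
  rw [← h.map_expansion_zero (h.coeffs b), h.expansion_coeffs]

/-- Naturality and uniqueness of Teichmüller expansions turn a relation in a lift into equations in
the residue ring. -/
theorem map_eq_zero_iff_coeffs (hB : IsPerfectLift p t q) (hD : IsPerfectLift p t' q')
    {f : B →+* D} {g : R →+* S} (hf : f t = t') (hfg : ∀ b, q' (f b) = g (q b)) (b : B) :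
    f b = 0 ↔ ∀ i, g (hB.coeffs b i) = 0 := by
  rw [← hD.expansion_zero, ← congrArg f (hB.expansion_coeffs b),
    hB.expansion_naturality hD hf hfg, hD.expansion_injective.eq_iff, funext_iff]

end IsPerfectLift

/-- The defining relations, inside a ring `D`, for a map `A → D` to be a ring homomorphism taking
`ϖ` to `t`. -/
inductive HomRel {A D : Type*} [CommRing A] [CommRing D] (Φ : A → D) (ϖ : A) (t : D) : D → Prop
  | add (a b : A) : HomRel Φ ϖ t (Φ (a + b) - (Φ a + Φ b))
  | mul (a b : A) : HomRel Φ ϖ t (Φ (a * b) - Φ a * Φ b)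
  | one : HomRel Φ ϖ t (Φ 1 - 1)
  | unif : HomRel Φ ϖ t (Φ ϖ - t)

theorem HomRel.map_eq_zero {A D E : Type*} [CommRing A] [CommRing D] [CommRing E] {Φ : A → D}
    {ϖ : A} {t : D} {f : D →+* E} {ψ : A →+* E} (hf : ∀ a, f (Φ a) = ψ a) (ht : ψ ϖ = f t) {d : D}
    (hd : HomRel Φ ϖ t d) : f d = 0 := by
  induction hd <;> simp [hf, ht]

/-- The ring homomorphism obtained by killing the relations `HomRel`. -/
def homOfHomRel {A D E : Type*} [CommRing A] [CommRing D] [CommRing E] {Φ : A → D} {ϖ : A} {t : D}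
    {f : D →+* E} (hf : ∀ d, HomRel Φ ϖ t d → f d = 0) : A →+* E :=
  RingHom.mk' ⟨⟨fun a => f (Φ a), by simpa [sub_eq_zero] using hf _ .one⟩,
    fun a b => by simpa [sub_eq_zero] using hf _ (.mul a b)⟩
    fun a b => by simpa [sub_eq_zero] using hf _ (.add a b)

/-- For a ring `A` and an element `ϖ`, there is a universal lift of a perfect `𝔽_p`-algebra
under `A` along the image of `ϖ`. -/
theorem exists_universal_isPerfectLift (A : Type u) [CommRing A] (ϖ : A) :
    ∃ (U S : Type u) (_ : CommRing U) (_ : CommRing S) (q : U →+* S) (φ : A →+* U),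
      IsPerfectLift p (φ ϖ) q ∧
      ∀ (B R : Type u) [CommRing B] [CommRing R] (q' : B →+* R) (ψ : A →+* B),
        IsPerfectLift p (ψ ϖ) q' → ∃! f : U →+* B, f.comp φ = ψ := by
  let T := FreePerfectAlg p (A × ℕ)
  let x (a : A) (i : ℕ) : T := FreePerfectAlg.var p (a, i)
  have hT : IsPerfectAlg p T := FreePerfectAlg.isPerfectAlg _
  -- Modulo `ξT`, `p` equals its own generic expansion. Indices start at `1` because the zeroth
  -- coefficient of `p` vanishes in a perfect residue ring.
  let ξT : PowerSeries (WittVector p T) :=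
    (p : PowerSeries (WittVector p T)) - X * teichSeries p fun i => x p (i + 1)
  have hξT : constantCoeff ξT = p := by simp [ξT]
  let hDT := WittQuotient.isPerfectLift hT hξT
  let Φ (a : A) : WittQuotient ξT := hDT.expansion (x a)
  let rel := HomRel Φ ϖ (Ideal.Quotient.mk _ X)
  -- Killing these coefficients imposes the relations; the radical keeps the quotient perfect.
  let I : Ideal T := (Ideal.span {r | ∃ d, rel d ∧ ∃ i, hDT.coeffs d i = r}).radical
  have hI (d) (hd : rel d) (i : ℕ) : hDT.coeffs d i ∈ I :=
    Ideal.le_radical (Ideal.subset_span ⟨d, hd, i, rfl⟩)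
  let S := T ⧸ I
  have hS : IsPerfectAlg p S := isPerfectAlg_quotient hT (Ideal.radical_isRadical _)
  let ξS := wittSeriesMap p (Ideal.Quotient.mk I) ξT
  have hξS : constantCoeff ξS = p := by 
    rw [constantCoeff_wittSeriesMap, hξT, map_natCast]
  let hDS := WittQuotient.isPerfectLift hS hξS
  obtain ⟨π, hπX, hπ⟩ := hDT.exists_lift hDS (Ideal.Quotient.mk I) hξT
    (WittQuotient.theta_self hT hξT) (WittQuotient.theta_self hS hξS)
  have hrel (d) (hd : rel d) : π d = 0 := by
    rw [hDT.map_eq_zero_iff_coeffs hDS hπX hπ]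
    exact fun i => Ideal.Quotient.eq_zero_iff_mem.2 (hI d hd i)
  let φ : A →+* WittQuotient ξS := homOfHomRel hrel
  have hφ (a : A) : φ a = hDS.expansion fun i => Ideal.Quotient.mk I (x a i) :=
    hDT.expansion_naturality hDS hπX hπ (x a)
  have hφϖ : φ ϖ = Ideal.Quotient.mk _ X := by
    have := hrel _ .unif
    rwa [map_sub, sub_eq_zero, hπX] at this
  refine ⟨WittQuotient ξS, S, inferInstance, inferInstance, _, φ, hφϖ ▸ hDS, ?_⟩
  intro B R _ _ q' ψ hB
  refine existsUnique_of_exists_of_unique ?_ ?_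
  · obtain ⟨g, hg⟩ := FreePerfectAlg.exists_hom hB.perfect fun i : A × ℕ => hB.coeffs (ψ i.1) i.2
    -- This is the Teichmüller expansion of `ψ p = p` in `B`.
    have hgξ : hB.theta (wittSeriesMap p g ξT) = 0 := by
      have h1 := hB.expansion_coeffs (ψ p)
      rw [hB.expansion_eq, hB.coeffs_zero, map_natCast, map_natCast, hB.perfect.cast_eq_zero,
        WittVector.teichmuller_zero, map_zero, map_zero, zero_add] at h1
      simp only [ξT, map_sub, map_mul, map_natCast, wittSeriesMap_X, wittSeriesMap_teichSeries,
        IsPerfectLift.theta_X, x, hg]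
      rw [sub_eq_zero, eq_comm]
      exact h1
    obtain ⟨H, hHX, hH⟩ := hDT.exists_lift hB g hξT (WittQuotient.theta_self hT hξT) hgξ
    have hHΦ (a : A) : H (Φ a) = ψ a := by
      rw [hDT.expansion_naturality hB hHX hH]
      simp only [x, hg]
      exact hB.expansion_coeffs (ψ a)
    have hIg : I ≤ RingHom.ker g := by
      have hrad : (RingHom.ker g).IsRadical := by
        rintro y ⟨n, hn⟩
        rw [RingHom.mem_ker, map_pow] at hn
        exact hB.perfect.eq_zero_of_pow_eq_zero hn
      refine hrad.radical_le_iff.2 (Ideal.span_le.2 ?_)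
      rintro _ ⟨d, hd, i, rfl⟩
      exact (hDT.map_eq_zero_iff_coeffs hB hHX hH d).1 (hd.map_eq_zero hHΦ hHX.symm) i
    let gS : S →+* R := Ideal.Quotient.lift I g fun y hy => hIg hy
    have hgS : gS.comp (Ideal.Quotient.mk I) = g := RingHom.ext fun _ => rfl
    obtain ⟨f, hfX, hf⟩ := hDS.exists_lift hB gS hξS (WittQuotient.theta_self hS hξS)
      (by rw [← wittSeriesMap_comp, hgS, hgξ])
    refine ⟨f, RingHom.ext fun a => ?_⟩
    rw [RingHom.comp_apply, hφ, hDS.expansion_naturality hB hfX hf]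
    exact (hDT.expansion_naturality hB hHX hH _).symm.trans (hHΦ a)
  · intro f f' hf hf'
    -- For uniqueness, agreement on the image of `A` forces agreement on all its Teichmüller
    -- coefficients, which determine the reduction on `S`.
    have hft : f (Ideal.Quotient.mk _ X) = ψ ϖ := by rw [← hf, RingHom.comp_apply, hφϖ]
    have hft' : f' (Ideal.Quotient.mk _ X) = ψ ϖ := by rw [← hf', RingHom.comp_apply, hφϖ]
    obtain ⟨g, hg⟩ := hDS.exists_reduction hB hft
    obtain ⟨g', hg'⟩ := hDS.exists_reduction hB hft'
    refine hDS.hom_ext hB hft hft' fun b => ?_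
    rw [hg, hg']
    congr 1
    refine Ideal.Quotient.ringHom_ext (FreePerfectAlg.hom_ext hB.perfect fun ⟨a, i⟩ => ?_)
    have h1 := RingHom.congr_fun (hf.trans hf'.symm) a
    rw [RingHom.comp_apply, RingHom.comp_apply, hφ, hDS.expansion_naturality hB hft hg,
      hDS.expansion_naturality hB hft' hg'] at h1
    exact congrFun (hB.expansion_injective h1) i

end Universal

/-! ### Complete residual perfections as lifts along a uniformizer. -/

section CRP

variable {p : ℕ} {A : Type u} [CommRing A] [IsDomain A] [IsDiscreteValuationRing A]

theorem extIdeal_eq_span {ϖ : A} (hϖ : Irreducible ϖ) (B : Type u) [CommRing B] [Algebra A B] :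
    extIdeal A B = Ideal.span {algebraMap A B ϖ} := by
  rw [extIdeal, hϖ.maximalIdeal_eq, Ideal.map_span, Set.image_singleton]

theorem IsCompleteResidualPerfection.isPerfectLift {ϖ : A} (hϖ : Irreducible ϖ) {B : Type u}
    [CommRing B] [Algebra A B] (h : IsCompleteResidualPerfection A p B) :
    IsPerfectLift p (algebraMap A B ϖ) (Ideal.Quotient.mk (extIdeal A B)) where
  regular x hx := by
    have := h.flat
    rw [← Algebra.smul_def] at hx
    exact (smul_eq_zero.1 hx).resolve_left hϖ.ne_zero
  complete := extIdeal_eq_span hϖ B ▸ h.complete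
  surjective := Ideal.Quotient.mk_surjective
  ker_eq := by rw [Ideal.mk_ker, extIdeal_eq_span hϖ]
  perfect := h.perfect

/-- Every nonzero element of `A` is a unit times a power of `ϖ`, so regularity of `ϖ` gives
torsion-freeness, hence flatness. -/
theorem IsPerfectLift.isCompleteResidualPerfection {ϖ : A} (hϖ : Irreducible ϖ) {B R : Type u}
    [CommRing B] [CommRing R] [Algebra A B] {q : B →+* R}
    (h : IsPerfectLift p (algebraMap A B ϖ) q) : IsCompleteResidualPerfection A p B where
  flat := by
    have : Module.IsTorsionFree A B := by
      refine ⟨fun r hr x y hxy => ?_⟩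
      obtain ⟨n, v, rfl⟩ := IsDiscreteValuationRing.eq_unit_mul_pow_irreducible hr.ne_zero hϖ
      have hxy' : (v : A) • ϖ ^ n • x = (v : A) • ϖ ^ n • y := by simpa [mul_smul] using hxy
      replace hxy' : ϖ ^ n • x = ϖ ^ n • y := v.isUnit.smul_left_cancel.1 hxy'
      clear hxy hr
      induction n with
      | zero => simpa using hxy'
      | succ n ih =>
        refine ih (h.cancel ?_)
        simpa [pow_succ', mul_assoc, Algebra.smul_def] using hxy'
    infer_instance
  complete := (extIdeal_eq_span hϖ B).symm ▸ h.complete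
  perfect := by
    have e : Reduction A B ≃+* R :=
      (Ideal.quotEquivOfEq ((extIdeal_eq_span hϖ B).trans h.ker_eq.symm)).trans
        (RingHom.quotientKerEquivOfSurjective h.surjective)
    refine ⟨e.injective (by rw [map_natCast, map_zero, h.perfect.cast_eq_zero]), ?_⟩
    have : (fun x : Reduction A B => x ^ p) = e.symm ∘ (fun x : R => x ^ p) ∘ e := by
      ext x
      simp
    rw [this]
    exact e.symm.bijective.comp (h.perfect.bijective_frobenius.comp e.bijective)

end CRP

/-! ### Lifting maps and perfect algebras over a base lift `U`. -/

section Lifting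

variable {p : ℕ} {A : Type u} [CommRing A] [IsDomain A] [IsDiscreteValuationRing A]
  {U B D : Type u} [CommRing U] [Algebra A U] [CommRing B] [Algebra A B] [CommRing D] [Algebra A D]

theorem algHom_ext_of_reductionMap (hB : IsCompleteResidualPerfection A p B)
    (hD : IsCompleteResidualPerfection A p D) {f g : B →ₐ[A] D}
    (h : reductionMap f = reductionMap g) : f = g := by
  obtain ⟨ϖ, hϖ⟩ := IsDiscreteValuationRing.exists_irreducible A
  have := (hB.isPerfectLift hϖ).hom_ext (hD.isPerfectLift hϖ) (f := (f : B →+* D))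
    (g := (g : B →+* D)) (f.commutes ϖ) (g.commutes ϖ)
    fun b => RingHom.congr_fun h (Ideal.Quotient.mk _ b)
  exact AlgHom.ext (RingHom.congr_fun this)

variable [Fact p.Prime]

/-- The `ξ` of `U` pushes forward to one for `B`, and compatibility of `g` with `U` makes its
further image die in `D`. -/
theorem exists_algHom_reductionMap_eq (hU : IsCompleteResidualPerfection A p U)
    (hB : IsCompleteResidualPerfection A p B) (hD : IsCompleteResidualPerfection A p D)
    (i : U →ₐ[A] B) (j : U →ₐ[A] D) (g : Reduction A B →+* Reduction A D)
    (hg : ∀ r, g (reductionMap i r) = reductionMap j r) :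
    ∃ f : B →ₐ[A] D, reductionMap f = g := by
  obtain ⟨ϖ, hϖ⟩ := IsDiscreteValuationRing.exists_irreducible A
  have lU := hU.isPerfectLift hϖ
  have lB := hB.isPerfectLift hϖ
  have lD := hD.isPerfectLift hϖ
  obtain ⟨ξ, hξ, hUξ⟩ := lU.exists_theta_eq_zero
  have hBξ : lB.theta (wittSeriesMap p (reductionMap i) ξ) = 0 := by
    rw [← lU.theta_naturality lB (f := (i : U →+* B)) (i.commutes ϖ) (fun _ => rfl), hUξ, map_zero]
  have hDξ : lD.theta (wittSeriesMap p g (wittSeriesMap p (reductionMap i) ξ)) = 0 := by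
    rw [← wittSeriesMap_comp, ← lU.theta_naturality lD (f := (j : U →+* D))
      (g := g.comp (reductionMap i)) (j.commutes ϖ)
      (fun b => (hg (Ideal.Quotient.mk _ b)).symm), hUξ, map_zero]
  obtain ⟨f, hft, hf⟩ := lB.exists_lift lD g
    (by rw [constantCoeff_wittSeriesMap, hξ, map_natCast]) hBξ hDξ
  -- The lift is so far only a ring map respecting `ϖ`; `A`-linearity follows because both maps from
  -- `U` have the same reduction.
  have hfi : f.comp (i : U →+* B) = j := by
    refine lU.hom_ext lD ?_ (j.commutes ϖ) fun b => ?_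
    · rw [RingHom.comp_apply, RingHom.coe_coe, i.commutes, hft]
    · exact (hf _).trans (hg (Ideal.Quotient.mk _ b))
  refine ⟨{ f with commutes' := fun a => ?_ }, Ideal.Quotient.ringHom_ext (RingHom.ext hf)⟩
  have := RingHom.congr_fun hfi (algebraMap A U a)
  simpa using this

/-- The image of the `ξ` of `U` still has constant coefficient `p`, so its quotient lifts `R` and
receives a map from `U`, hence an `A`-algebra structure. -/
theorem exists_lift_of_reduction (hU : IsCompleteResidualPerfection A p U) {R : Type u}
    [CommRing R] (hR : IsPerfectAlg p R) (g : Reduction A U →+* R) :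
    ∃ (B : Type u) (_ : CommRing B) (_ : Algebra A B) (_ : IsCompleteResidualPerfection A p B)
      (f : U →ₐ[A] B) (e : Reduction A B ≃+* R), ∀ r, e (reductionMap f r) = g r := by
  obtain ⟨ϖ, hϖ⟩ := IsDiscreteValuationRing.exists_irreducible A
  have lU := hU.isPerfectLift hϖ
  obtain ⟨ξ, hξ, hUξ⟩ := lU.exists_theta_eq_zero
  have hξ' : PowerSeries.constantCoeff (wittSeriesMap p g ξ) = p := by
    rw [constantCoeff_wittSeriesMap, hξ, map_natCast]
  have lB := WittQuotient.isPerfectLift hR hξ'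
  obtain ⟨f, hft, hf⟩ := lU.exists_lift lB g hξ hUξ (WittQuotient.theta_self hR hξ')
  let : Algebra A (WittQuotient (wittSeriesMap p g ξ)) := (f.comp (algebraMap A U)).toAlgebra
  rw [← hft] at lB
  refine ⟨_, inferInstance, inferInstance, lB.isCompleteResidualPerfection hϖ,
    { f with commutes' := fun _ => rfl },
    (Ideal.quotEquivOfEq ((extIdeal_eq_span hϖ _).trans lB.ker_eq.symm)).trans
      (RingHom.quotientKerEquivOfSurjective lB.surjective), fun r => ?_⟩
  obtain ⟨b, rfl⟩ := Ideal.Quotient.mk_surjective r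
  exact hf b

end Lifting

/-! ### The initial object and the equivalence. -/

section Main

variable (p : ℕ) [Fact p.Prime] (A : Type u) [CommRing A] [IsDomain A] [IsDiscreteValuationRing A]

theorem exists_isInitial : ∃ U : CRP A p, Nonempty (Limits.IsInitial U) := by
  obtain ⟨ϖ, hϖ⟩ := IsDiscreteValuationRing.exists_irreducible A
  obtain ⟨U, S, _, _, q, φ, hU, huniv⟩ := exists_universal_isPerfectLift (p := p) A ϖ
  let : Algebra A U := φ.toAlgebra
  have key (B : CRP A p) := huniv B.obj _ _ (algebraMap A B.obj) (B.property.isPerfectLift hϖ)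
  choose f hf huniq using key
  refine ⟨⟨CommAlgCat.of A U, IsPerfectLift.isCompleteResidualPerfection hϖ hU⟩,
    ⟨Limits.IsInitial.ofUniqueHom (fun B => ObjectProperty.homMk (CommAlgCat.ofHom
      { f B with commutes' := RingHom.congr_fun (hf B) })) fun B m => ?_⟩⟩
  apply ObjectProperty.hom_ext
  apply CommAlgCat.hom_ext
  apply AlgHom.ext
  exact RingHom.congr_fun (huniq B (m.hom.hom : U →+* B.obj) (RingHom.ext m.hom.hom.commutes))

variable {p A}

theorem reductionFunctor_isEquivalence (U : CRP A p) (hU : Limits.IsInitial U) :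
    (reductionFunctor U hU).IsEquivalence where
  faithful := ⟨fun {B D f g} h => by
    apply ObjectProperty.hom_ext
    apply CommAlgCat.hom_ext
    refine algHom_ext_of_reductionMap B.property D.property (RingHom.ext fun x => ?_)
    exact congrArg (fun k : (reductionFunctor U hU).obj B ⟶ (reductionFunctor U hU).obj D =>
      k.hom.hom x) h⟩
  full := ⟨fun {B D} g => by
    obtain ⟨f, hf⟩ := exists_algHom_reductionMap_eq U.property B.property D.property
      (hU.to B).hom.hom (hU.to D).hom.hom g.hom.hom.toRingHom g.hom.hom.commutes
    refine ⟨ObjectProperty.homMk (CommAlgCat.ofHom f), ?_⟩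
    apply ObjectProperty.hom_ext
    apply CommAlgCat.hom_ext
    apply AlgHom.ext
    exact RingHom.congr_fun hf⟩
  essSurj := ⟨fun R => by
    obtain ⟨B, _, _, hB, f, e, he⟩ := exists_lift_of_reduction U.property R.property
      (algebraMap (Reduction A U.obj) R.obj)
    let B' : CRP A p := ⟨CommAlgCat.of A B, hB⟩
    have hf : hU.to B' = ObjectProperty.homMk (CommAlgCat.ofHom f) := hU.hom_ext _ _
    let := (reductionMap (hU.to B').hom.hom).toAlgebra
    let e' : Reduction A B ≃ₐ[Reduction A U.obj] R.obj := AlgEquiv.ofRingEquiv (f := e) fun r => by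
      refine Eq.trans ?_ (he r)
      change e (reductionMap (hU.to B').hom.hom r) = _
      rw [hf]
      rfl
    exact ⟨B', ⟨ObjectProperty.isoMk _ (CommAlgCat.isoMk e')⟩⟩⟩

end Main

end ResidualPerfection

theorem mainTheorem1 (p : ℕ) [Fact p.Prime] (A : Type u) [CommRing A] [IsDomain A]
    [IsDiscreteValuationRing A] [CharP (IsLocalRing.ResidueField A) p] :
    (∃ U : ResidualPerfection.CRP A p, Nonempty (Limits.IsInitial U)) ∧
      ∀ (U : ResidualPerfection.CRP A p) (hU : Limits.IsInitial U),
        (ResidualPerfection.reductionFunctor U hU).IsEquivalence :=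
  ⟨ResidualPerfection.exists_isInitial p A, ResidualPerfection.reductionFunctor_isEquivalence⟩
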